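/- Let $(Y,Z)\sim P_Y$ and $(X,Z)\sim P_X$ be random pairs with values in $\mathbf R\times\mathbf R$ (the marginal laws of $Z$ under $P_Y$ and under $P_X$ may differ), and let $F_Y(t|z)=P_Y\{Y\le t\mid Z=z\}$ and $F_X(t|z)=P_X\{X\le t\mid Z=z\}$ be the conditional distribution functions, computed from fixed versions of the regular conditional distributions. Let $\mathcal Z\subset\mathbf R$ be a finite set of target points and let $z_0\in\mathcal Z$. Assume: (i) for every $\varepsilon>0$ and $z\in\mathcal Z$, $P\{Z\in(z-\varepsilon,z+\varepsilon)\}>0$, under both $P_Y$ and $P_X$; (ii) for every $z\in\mathcal Z$, $\sup_{t\in\mathbf R}|F_Y(t|z_k)-F_Y(t|z)|\to0$ for every sequence $z_k\to z$ in the support of $Z$ under $P_Y$, and $\sup_{t\in\mathbf R}|F_X(t|z_k)-F_X(t|z)|\to 0$ for every sequence $z_k\to z$ in the support of $Z$ under $P_X$; (iii) $F_Y(\cdot|z_0)$ and $F_X(\cdot|z_0)$ are continuous on $\mathbf R$; (iv) (null hypothesis) $F_Y(t|z)\le F_X(t|z)$ for all $(t,z)\in\mathbf R\times\mathcal Z$.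 One observes two independent samples: $n_y$ i.i.d. draws $(Y_i,Z_i)$ from $P_Y$ and $n_x$ i.i.d. draws $(X_j,Z_j)$ from $P_X$; $P$ denotes their joint law. Fix positive integers $q_y,q_x$ and put $q=q_y+q_x$. Let $S_n=(S_{n,1},\dots,S_{n,q})$ consist of the $q_y$ values $Y_i$ whose $Z_i$ are closest to $z_0$ in the $Y$-sample, in order of increasing distance $|Z_i-z_0|$, followed by the $q_x$ values $X_j$ whose $Z_j$ are closest to $z_0$ in the $X$-sample, in order of increasing distance; ties in distance are resolved by an arbitrary measurable rule that depends only on the $Z$-values of the respective sample (for example by sample order). For $s\in\mathbf R^q$ put $$\hat F_Y(t)=\frac1{q_y}\sum_{j=1}^{q_y}I\{s_j\le t\},\qquad \hat F_X(t)=\frac1{q_x}\sum_{j=1}^{q_x}I\{s_{q_y+j}\le t\},\qquad T_{\rm CvM}(s)=\frac1q\sum_{j=1}^{q}\Bigl(\max\{\hat F_Y(s_j)-\hat F_X(s_j),0\}\Bigr)^2 .$$ Let $\alpha\in(0,1)$, let $U=(U_1,\dots,U_q)$ be i.i.d. uniform on $(0,1)$, and let $$c_{\alpha,{\rm CvM}}(q_y,q)=\inf\bigl\{x\in\mathbf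 R: P\{T_{\rm CvM}(U)\le x\}\ge 1-\alpha\bigr\},\qquad \phi_{\rm CvM}(s)=I\{T_{\rm CvM}(s)>c_{\alpha,{\rm CvM}}(q_y,q)\}.$$ Then, with $q_y,q_x$ fixed and $n=\min\{n_y,n_x\}$, $$\limsup_{n\to\infty}E_P[\phi_{\rm CvM}(S_n)]\le\alpha .$$ -/

import Mathlib

open MeasureTheory ProbabilityTheory Filter Topology

namespace CSD

noncomputable section

/-! ### The population: conditional distributions, regularity, null hypothesis

A measure `μ` on `ℝ × ℝ` is the joint law of a pair `(Y, Z)` (first coordinate the outcome, second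
coordinate the conditioning variable). -/

/-- The Markov kernel `κ` is a version of the conditional distribution of `Y` given `Z`
when `(Y, Z) ∼ μ`, i.e. the law of `(Z, Y)` is `P_Z(dz) κ(z, dy)`. -/
def IsCondLaw (μ : Measure (ℝ × ℝ)) (κ : Kernel ℝ ℝ) : Prop :=
  μ.map Prod.swap = (μ.map Prod.snd) ⊗ₘ κ

/-- The conditional distribution function `F(t | z)`. -/
def condF (κ : Kernel ℝ ℝ) (t z : ℝ) : ℝ := cdf (κ z) t

/-- `Z` charges every neighbourhood of every target point. -/
def ChargesTargets (μ : Measure (ℝ × ℝ)) (Zset : Finset ℝ) : Prop :=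
  ∀ ε : ℝ, 0 < ε → ∀ z ∈ Zset, 0 < μ {p | p.2 ∈ Set.Ioo (z - ε) (z + ε)}

/-- At every target point `z`, `sup_t |F(t | z_k) - F(t | z)| → 0` for each sequence `z_k → z`
in the support of `Z`. -/
def CondFContinuousAtTargets (μ : Measure (ℝ × ℝ)) (κ : Kernel ℝ ℝ) (Zset : Finset ℝ) : Prop :=
  ∀ z ∈ Zset, ∀ zk : ℕ → ℝ, (∀ k, zk k ∈ (μ.map Prod.snd).support) → Tendsto zk atTop (𝓝 z) →
    Tendsto (fun k => ⨆ t : ℝ, |condF κ t (zk k) - condF κ t z|) atTop (𝓝 0)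

/-- The null hypothesis of conditional stochastic dominance on the target set. -/
def NullHypothesis (κY κX : Kernel ℝ ℝ) (Zset : Finset ℝ) : Prop :=
  ∀ t : ℝ, ∀ z ∈ Zset, condF κY t z ≤ condF κX t z

/-! ### Induced order statistics -/

/-- A rule that, for every sample size `n`, orders the observed values `z_1, …, z_n` by their
distance to `z0`: `perm n z i` is the index of the `i`-th closest value. Ties are resolved in an
arbitrary (measurable) way, as a function of the `Z`-values. -/
structure GOrderRule (z0 : ℝ) where
  perm : (n : ℕ) → (Fin n → ℝ) → Equiv.Perm (Fin n)
  monotone_dist : ∀ (n : ℕ) (z : Fin n → ℝ), Monotone fun i => |z (perm n z i) - z0|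
  measurable_perm : ∀ (n : ℕ) (i : Fin n), Measurable fun z : Fin n → ℝ => perm n z i

/-- The rule that resolves ties by the original sample order. -/
def GOrderRule.sampleOrder (z0 : ℝ) : GOrderRule z0 where
  perm n z := Tuple.sort fun i => |z i - z0|
  monotone_dist n z := Tuple.monotone_sort fun i => |z i - z0|
  measurable_perm n i := by
    refine measurable_to_countable' fun k => ?_
    have h : (fun z : Fin n → ℝ => (Tuple.sort fun i => |z i - z0|) i) ⁻¹' {k} =
        ⋃ σ ∈ {σ : Equiv.Perm (Fin n) | σ i = k},
          {z : Fin n → ℝ | σ = Tuple.sort fun i => |z i - z0|} := by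
      ext z
      simp
    rw [h]
    refine MeasurableSet.biUnion (Set.to_countable _) fun σ _ => ?_
    have h2 : {z : Fin n → ℝ | σ = Tuple.sort fun i => |z i - z0|} =
        (⋂ a, ⋂ b, ⋂ _ : a ≤ b, {z : Fin n → ℝ | |z (σ a) - z0| ≤ |z (σ b) - z0|}) ∩
        (⋂ a, ⋂ b, ⋂ _ : a < b, ⋂ _ : ¬ σ a < σ b,
          {z : Fin n → ℝ | |z (σ a) - z0| = |z (σ b) - z0|}ᶜ) := by
      ext z
      simp only [Set.mem_ofPred_eq, Tuple.eq_sort_iff, Set.mem_inter_iff, Set.mem_iInter,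
        Set.mem_compl_iff, Monotone, Function.comp]
      refine and_congr Iff.rfl ?_
      exact forall_congr' fun a => forall_congr' fun b => forall_congr' fun _ =>
        ⟨fun h h1 h2 => h1 (h h2), fun h h2 => by_contra fun h1 => h h1 h2⟩
    rw [h2]
    refine MeasurableSet.inter ?_ ?_
    · refine .iInter fun a => .iInter fun b => .iInter fun _ => measurableSet_le ?_ ?_ <;> fun_prop
    · refine .iInter fun a => .iInter fun b => .iInter fun _ => .iInter fun _ =>
        (measurableSet_eq_fun ?_ ?_).compl <;> fun_prop

/-- The first `q` induced order statistics of a sample `w_i = (Y_i, Z_i)`, `i = 1, …, n`: the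
`Y`-values that belong to the `q` values of `Z` closest to `z0`. (They are defined when `q ≤ n`;
indices beyond `n` get the value `0`.) -/
def inducedOrderStat {z0 : ℝ} (r : GOrderRule z0) (q : ℕ) {n : ℕ} (w : Fin n → ℝ × ℝ) :
    Fin q → ℝ := fun j =>
  if h : (j : ℕ) < n then (w (r.perm n (fun i => (w i).2) ⟨j, h⟩)).1 else 0

/-- The pooled vector `S_n` of induced order statistics: `qy` from the `Y`-sample, followed by
`qx` from the `X`-sample. -/
def pooled {z0 : ℝ} (rY rX : GOrderRule z0) (qy qx : ℕ) {ny nx : ℕ}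
    (w : (Fin ny → ℝ × ℝ) × (Fin nx → ℝ × ℝ)) : Fin (qy + qx) → ℝ :=
  Fin.append (inducedOrderStat rY qy w.1) (inducedOrderStat rX qx w.2)

/-! ### The one-sided Cramér–von Mises test -/

/-- Empirical distribution function of the first `qy` entries. -/
def empY {qy qx : ℕ} (s : Fin (qy + qx) → ℝ) (t : ℝ) : ℝ :=
  (1 / (qy : ℝ)) * ∑ j : Fin qy, if s (Fin.castAdd qx j) ≤ t then 1 else 0

/-- Empirical distribution function of the last `qx` entries. -/
def empX {qy qx : ℕ} (s : Fin (qy + qx) → ℝ) (t : ℝ) : ℝ :=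
  (1 / (qx : ℝ)) * ∑ j : Fin qx, if s (Fin.natAdd qy j) ≤ t then 1 else 0

/-- The one-sided Cramér–von Mises statistic. -/
def cvmStat {qy qx : ℕ} (s : Fin (qy + qx) → ℝ) : ℝ :=
  (1 / ((qy + qx : ℕ) : ℝ)) * ∑ j : Fin (qy + qx), (max (empY s (s j) - empX s (s j)) 0) ^ 2

/-- The law of a vector of `q` i.i.d. random variables that are uniform on `(0, 1)`. -/
def uniformLaw (q : ℕ) : Measure (Fin q → ℝ) :=
  Measure.pi fun _ => volume.restrict (Set.Ioo (0 : ℝ) 1)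

/-- The critical value: the `1 - α` quantile of the statistic at i.i.d. uniforms. -/
def cvmCritical (α : ℝ) (qy qx : ℕ) : ℝ :=
  sInf {x : ℝ | 1 - α ≤ (uniformLaw (qy + qx)).real {u | cvmStat (qy := qy) (qx := qx) u ≤ x}}

/-- The test: `1` (reject) if the statistic exceeds the critical value, `0` otherwise. -/
def cvmTest (α : ℝ) {qy qx : ℕ} (s : Fin (qy + qx) → ℝ) : ℝ :=
  if cvmCritical α qy qx < cvmStat s then 1 else 0

/-! ### Sampling -/

/-- The law of two independent i.i.d. samples, of size `ny` from `PY` and of size `nx`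
from `PX`. -/
def samplingLaw (PY PX : Measure (ℝ × ℝ)) (ny nx : ℕ) :
    Measure ((Fin ny → ℝ × ℝ) × (Fin nx → ℝ × ℝ)) :=
  (Measure.pi fun _ : Fin ny => PY).prod (Measure.pi fun _ : Fin nx => PX)

/-- The rejection probability `E_P[φ(S_n)]` of the test. -/
def cvmRejection (PY PX : Measure (ℝ × ℝ)) {z0 : ℝ} (rY rX : GOrderRule z0) (α : ℝ)
    (qy qx ny nx : ℕ) : ℝ :=
  ∫ w, cvmTest α (pooled rY rX qy qx w) ∂(samplingLaw PY PX ny nx)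

end

end CSD

namespace CSD

/-! ### Finite products of kernels -/

section PiKernel

variable {ι α β : Type*} [Fintype ι] [MeasurableSpace α] [MeasurableSpace β]

/-! Which observations are selected depends on the `Z`-values only. Given these values, the induced
order statistics are therefore independent, the `j`-th one with law `κ` at the `j`-th closest value
(`pi_inducedOrderStat_rect`). Since `Z` charges every neighbourhood of `z0`, the `q` closest values
tend to `z0` in probability (`tendsto_pi_card_lt`, `abs_closestZ_sub_lt`). Almost surely they lie in
the support, so continuity of the conditional cdf there gives weak convergence to the product of
copies of `κ z0` (`tendsto_inducedLaw`).

The statistic depends only on the order of the coordinates, so it is locally constant off ties, and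
ties are null because the limit marginals are atomless. Hence the rejection probabilities converge
to that of the limit experiment (`tendsto_samplingLaw_pooled`).

In the limit experiment, apply to each coordinate its own cdf; the result is i.i.d. uniform. If `Y ≤
X`, then `F_Y(Y) ≤ F_Y(X) ≤ F_X(X)` under the null, so every comparison `Y ≤ X` survives, and the
statistic can only increase (`cvmStat_le_of_forall`). It is thus dominated by the statistic at
uniforms, which exceeds its own quantile with probability at most `α`. -/

lemma measurable_pi_kernel (η : Kernel α β) [IsMarkovKernel η] :
    Measurable fun z : ι → α => Measure.pi fun i => η (z i) := by
  refine Measurable.measure_of_isPiSystem_of_isProbabilityMeasure generateFrom_pi.symm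
    isPiSystem_pi ?_
  rintro _ ⟨s, hs, rfl⟩
  simp only [Measure.pi_pi]
  exact Finset.measurable_prod _ fun i _ =>
    (η.measurable_coe (hs i (Set.mem_univ i))).comp (measurable_pi_apply i)

lemma lintegral_pi_prod (ν : Measure α) [IsProbabilityMeasure ν] {f : ι → α → ENNReal}
    (hf : ∀ i, Measurable (f i)) :
    ∫⁻ z, ∏ i, f i (z i) ∂(Measure.pi fun _ : ι => ν) = ∏ i, ∫⁻ x, f i x ∂ν := by
  have h := lintegral_prod_eq_prod_lintegral_of_indepFun (μ := Measure.pi fun _ : ι => ν)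
    Finset.univ (fun i z => f i (z i)) (iIndepFun_pi fun i => (hf i).aemeasurable)
    (fun i => (hf i).comp (measurable_pi_apply i))
  rw [h]
  refine Finset.prod_congr rfl fun i _ => ?_
  exact (measurePreserving_eval (fun _ : ι => ν) i).lintegral_comp (hf i)

/-- Drawing i.i.d. from a mixture is the same as drawing the mixing variables i.i.d. first. -/
lemma pi_bind (ν : Measure α) [IsProbabilityMeasure ν] (η : Kernel α β) [IsMarkovKernel η] :
    (Measure.pi fun _ : ι => ν.bind η) =
      (Measure.pi fun _ : ι => ν).bind fun z => Measure.pi fun i => η (z i) := by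
  refine Measure.pi_eq fun s hs => ?_
  rw [Measure.bind_apply (MeasurableSet.univ_pi hs) (measurable_pi_kernel η).aemeasurable]
  simp only [Measure.pi_pi]
  rw [lintegral_pi_prod ν fun i => η.measurable_coe (hs i)]
  exact Finset.prod_congr rfl fun i _ =>
    (Measure.bind_apply (hs i) η.measurable.aemeasurable).symm

lemma pi_forall_mem_of_injective {κ : Type*} [Fintype κ] (μ : ι → Measure β)
    [∀ i, IsProbabilityMeasure (μ i)] {e : κ → ι} (he : e.Injective) {B : κ → Set β}
    (hB : ∀ j, MeasurableSet (B j)) :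
    Measure.pi μ {y | ∀ j, y (e j) ∈ B j} = ∏ j, μ (e j) (B j) := by
  have h := (iIndepFun_pi (μ := μ) (X := fun _ => id) fun _ => aemeasurable_id).precomp he
  have h2 := h.measure_inter_preimage_eq_mul Finset.univ (sets := B) fun j _ => hB j
  have h3 : {y : ι → β | ∀ j, y (e j) ∈ B j} =
      ⋂ j ∈ Finset.univ, (fun y : ι → β => id (y (e j))) ⁻¹' B j := by
    ext y; simp
  rw [h3, h2]
  exact Finset.prod_congr rfl fun j _ =>
    (measurePreserving_eval μ (e j)).measure_preimage (hB j).nullMeasurableSet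

end PiKernel

/-! ### The law of the induced order statistics -/

section InducedOrderStat

variable {z0 : ℝ} (r : GOrderRule z0)

lemma measurable_apply_perm {α : Type*} [MeasurableSpace α] {Ω : Type*} [MeasurableSpace Ω]
    {n : ℕ} (i : Fin n) {z : Ω → Fin n → ℝ} (hz : Measurable z) {f : Ω → Fin n → α}
    (hf : Measurable f) : Measurable fun ω => f ω (r.perm n (z ω) i) := by
  have h : Measurable fun p : Ω × Fin n => f p.1 p.2 :=
    measurable_from_prod_countable_left fun k => (measurable_pi_apply k).comp hf
  exact h.comp (measurable_id.prodMk ((r.measurable_perm n i).comp hz))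

lemma measurable_inducedOrderStat (q n : ℕ) :
    Measurable fun w : Fin n → ℝ × ℝ => inducedOrderStat r q w := by
  refine measurable_pi_lambda _ fun j => ?_
  unfold inducedOrderStat
  by_cases h : (j : ℕ) < n
  · simp only [h, dite_true]
    exact measurable_fst.comp
      (measurable_apply_perm r ⟨j, h⟩ (by fun_prop) measurable_id)
  · simp only [h, dite_false, measurable_const]

/-- The `Z`-values that are closest to the target. -/
def closestZ (q : ℕ) {n : ℕ} (h : q ≤ n) (z : Fin n → ℝ) : Fin q → ℝ := fun j =>
  z (r.perm n z (Fin.castLE h j))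

lemma measurable_closestZ {q n : ℕ} (h : q ≤ n) : Measurable (closestZ r q h) :=
  measurable_pi_lambda _ fun _ => measurable_apply_perm r _ measurable_id measurable_id

/-- Pairing `κ` with the identity keeps `z` as the second coordinate, so a pair is a draw from a
mixture and `pi_bind` applies to the whole sample. -/
lemma IsCondLaw.eq_bind {μ : Measure (ℝ × ℝ)} [IsProbabilityMeasure μ] {κ : Kernel ℝ ℝ}
    [IsMarkovKernel κ] (h : IsCondLaw μ κ) :
    μ = (μ.map Prod.snd).bind (κ ×ₖ Kernel.id) := by
  have : IsProbabilityMeasure (μ.map Prod.snd) :=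
    Measure.isProbabilityMeasure_map measurable_snd.aemeasurable
  have h1 : μ = (μ.map Prod.swap).map Prod.swap := by
    rw [Measure.map_map measurable_swap measurable_swap]; simp
  conv_lhs => rw [h1, h]
  ext s hs
  rw [Measure.map_apply measurable_swap hs, Measure.compProd_apply (measurable_swap hs),
    Measure.bind_apply hs (Kernel.aemeasurable _)]
  refine lintegral_congr fun z => ?_
  rw [Kernel.prod_apply, Kernel.id_apply, Measure.prod_dirac,
    Measure.map_apply (by fun_prop) hs]
  rfl

lemma pi_inducedOrderStat_rect {μ : Measure (ℝ × ℝ)} [IsProbabilityMeasure μ] {κ : Kernel ℝ ℝ}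
    [IsMarkovKernel κ] (hκ : IsCondLaw μ κ) {q n : ℕ} (h : q ≤ n) {B : Fin q → Set ℝ}
    (hB : ∀ j, MeasurableSet (B j)) :
    (Measure.pi fun _ : Fin n => μ) {w | ∀ j, inducedOrderStat r q w j ∈ B j} =
      ∫⁻ z, ∏ j, κ (closestZ r q h z j) (B j) ∂(Measure.pi fun _ : Fin n => μ.map Prod.snd) := by
  have : IsProbabilityMeasure (μ.map Prod.snd) :=
    Measure.isProbabilityMeasure_map measurable_snd.aemeasurable
  have hE : MeasurableSet {w : Fin n → ℝ × ℝ | ∀ j, inducedOrderStat r q w j ∈ B j} := by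
    have : {w : Fin n → ℝ × ℝ | ∀ j, inducedOrderStat r q w j ∈ B j} =
        (fun w => inducedOrderStat r q w) ⁻¹' Set.univ.pi B := by ext; simp
    rw [this]
    exact measurable_inducedOrderStat r q n (MeasurableSet.univ_pi hB)
  conv_lhs => rw [hκ.eq_bind, pi_bind]
  rw [Measure.bind_apply hE (measurable_pi_kernel _).aemeasurable]
  refine lintegral_congr fun z => ?_
  -- Given `z`, the second coordinates are frozen, so the random permutation becomes the fixed
  -- `r.perm n z` and selects distinct, hence independent, coordinates.
  have hfix : ∀ᵐ w ∂(Measure.pi fun i => (κ ×ₖ Kernel.id) (z i)), ∀ i, (w i).2 = z i := by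
    refine eventually_all.2 fun i => ?_
    refine (Measure.tendsto_eval_ae_ae (i := i)).eventually (p := fun p : ℝ × ℝ => p.2 = z i) ?_
    rw [Kernel.prod_apply, Kernel.id_apply, Measure.prod_dirac,
      ae_map_iff (by fun_prop) (measurableSet_eq_fun measurable_snd measurable_const)]
    simp
  have hset : {w : Fin n → ℝ × ℝ | ∀ j, inducedOrderStat r q w j ∈ B j}
      =ᵐ[Measure.pi fun i => (κ ×ₖ Kernel.id) (z i)]
      {w | ∀ j, w (r.perm n z (Fin.castLE h j)) ∈ B j ×ˢ Set.univ} := by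
    filter_upwards [hfix] with w hw
    have hz : (fun i => (w i).2) = z := funext hw
    refine propext (forall_congr' fun j => ?_)
    have hj : (j : ℕ) < n := j.2.trans_le h
    simp only [inducedOrderStat, hj, dite_true, hz, Set.mem_prod, Set.mem_univ, and_true]
    rfl
  rw [measure_congr hset]
  refine (pi_forall_mem_of_injective _ (e := fun j => r.perm n z (Fin.castLE h j))
    ((r.perm n z).injective.comp (Fin.castLE_injective h)) fun j => (hB j).prod .univ).trans ?_
  refine Finset.prod_congr rfl fun j _ => ?_
  simp [Kernel.prod_apply, Measure.prod_prod, closestZ]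

/-- If the value of rank `j` were at distance at least `ε`, so would be all later ranks, leaving at
most `j < q` values within `ε`. -/
lemma abs_closestZ_sub_lt {q n : ℕ} (h : q ≤ n) (z : Fin n → ℝ) {ε : ℝ}
    (hq : q ≤ (Finset.univ.filter fun i => |z i - z0| < ε).card) (j : Fin q) :
    |closestZ r q h z j - z0| < ε := by
  by_contra hcon
  rw [not_lt] at hcon
  have hsub : (Finset.univ.filter fun i => |z i - z0| < ε) ⊆
      (Finset.univ.filter fun k : Fin n => k < Fin.castLE h j).image (r.perm n z) := by
    intro i hi
    simp only [Finset.mem_filter, Finset.mem_univ, true_and, Finset.mem_image] at hi ⊢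
    refine ⟨(r.perm n z).symm i, ?_, by simp⟩
    by_contra hk
    have hm := r.monotone_dist n z (not_lt.1 hk)
    simp only [Equiv.apply_symm_apply] at hm
    exact absurd (hcon.trans hm) (not_le.2 hi)
  have hc := (Finset.card_le_card hsub).trans Finset.card_image_le
  have : (Finset.univ.filter fun k : Fin n => k < Fin.castLE h j).card = j := by
    rw [show (Finset.univ.filter fun k : Fin n => k < Fin.castLE h j) =
      Finset.Iio (Fin.castLE h j) by ext; simp, Fin.card_Iio]
    rfl
  omega

/-- In a large i.i.d. sample, at least `q` observations fall into a set of positive measure. -/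
lemma tendsto_pi_card_lt {α : Type*} [MeasurableSpace α] (ν : Measure α) [IsProbabilityMeasure ν]
    {B : Set α} (hB : MeasurableSet B) (hpos : 0 < ν B) [DecidablePred (· ∈ B)] (q : ℕ) :
    Tendsto (fun n : ℕ => (Measure.pi fun _ : Fin n => ν)
      {z | (Finset.univ.filter fun i => z i ∈ B).card < q}) atTop (𝓝 0) := by
  -- Chernoff bound: the product of the `f (z i)` is `2⁻¹` to the number of hits of `B`. Its
  -- expectation is the `n`-th power of `∫ f < 1`, and Markov's inequality at level `2⁻¹ ^ q`
  -- concludes.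
  set f : α → ENNReal := fun x => if x ∈ B then 2⁻¹ else 1 with hf
  have hfm : Measurable f := Measurable.ite hB measurable_const measurable_const
  have hlt : ∫⁻ x, f x ∂ν < 1 := by
    have h1 : ∫⁻ x, f x ∂ν + ∫⁻ x, B.indicator (fun _ => (2⁻¹ : ENNReal)) x ∂ν = 1 := by
      rw [← lintegral_add_left hfm]
      have : ∀ x, f x + B.indicator (fun _ => (2⁻¹ : ENNReal)) x = 1 := by
        intro x
        by_cases hx : x ∈ B <;> simp [hf, hx, ENNReal.inv_two_add_inv_two]
      simp [this]
    rw [lintegral_indicator_const hB] at h1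
    have h2 : (2⁻¹ : ENNReal) * ν B ≠ 0 := mul_ne_zero (by simp) hpos.ne'
    calc ∫⁻ x, f x ∂ν < ∫⁻ x, f x ∂ν + 2⁻¹ * ν B := by
          refine ENNReal.lt_add_right ?_ h2
          intro htop; simp [htop] at h1
      _ = 1 := h1
  have hbound : ∀ n : ℕ, (Measure.pi fun _ : Fin n => ν)
      {z | (Finset.univ.filter fun i => z i ∈ B).card < q} ≤ 2 ^ q * (∫⁻ x, f x ∂ν) ^ n := by
    intro n
    have hprod := lintegral_pi_prod (ι := Fin n) ν (f := fun _ => f) fun _ => hfm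
    rw [Finset.prod_const, Finset.card_univ, Fintype.card_fin] at hprod
    have hmk := mul_meas_ge_le_lintegral₀ (μ := Measure.pi fun _ : Fin n => ν)
      (f := fun z => ∏ i, f (z i))
      (Finset.measurable_prod _ fun i _ => hfm.comp (measurable_pi_apply i)).aemeasurable
      ((2⁻¹ : ENNReal) ^ q)
    rw [hprod] at hmk
    have hsub : {z : Fin n → α | (Finset.univ.filter fun i => z i ∈ B).card < q} ⊆
        {z | (2⁻¹ : ENNReal) ^ q ≤ ∏ i, f (z i)} := by
      intro z hz
      simp only [Set.mem_ofPred_eq] at hz ⊢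
      have : ∏ i, f (z i) = 2⁻¹ ^ (Finset.univ.filter fun i => z i ∈ B).card := by
        rw [hf, Finset.prod_ite]; simp
      rw [this]
      exact pow_le_pow_right_of_le_one' (by simp) hz.le
    calc _ ≤ (Measure.pi fun _ : Fin n => ν) {z | (2⁻¹ : ENNReal) ^ q ≤ ∏ i, f (z i)} :=
          measure_mono hsub
      _ = 2 ^ q * (2⁻¹ ^ q * (Measure.pi fun _ : Fin n => ν)
            {z | (2⁻¹ : ENNReal) ^ q ≤ ∏ i, f (z i)}) := by
          rw [← mul_assoc, ← mul_pow, ENNReal.mul_inv_cancel (by simp) (by simp), one_pow, one_mul]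
      _ ≤ _ := by gcongr
  have hlim : Tendsto (fun n : ℕ => 2 ^ q * (∫⁻ x, f x ∂ν) ^ n) atTop (𝓝 0) := by
    have := ENNReal.Tendsto.const_mul (a := 2 ^ q)
      (ENNReal.tendsto_pow_atTop_nhds_zero_of_lt_one hlt) (Or.inr (by simp))
    simpa using this
  exact tendsto_of_tendsto_of_tendsto_of_le_of_le tendsto_const_nhds hlim
    (fun _ => bot_le) hbound

end InducedOrderStat

end CSD

namespace CSD

/-! ### Weak convergence of the induced order statistics -/

section WeakLimit

lemma tendsto_condF {μ : Measure (ℝ × ℝ)} {κ : Kernel ℝ ℝ} [IsMarkovKernel κ] {Zset : Finset ℝ}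
    (hF : CondFContinuousAtTargets μ κ Zset) {z0 : ℝ} (hz0 : z0 ∈ Zset) (t : ℝ) :
    Tendsto (fun z => condF κ t z) (𝓝[(μ.map Prod.snd).support] z0) (𝓝 (condF κ t z0)) := by
  refine tendsto_of_seq_tendsto fun u hu => ?_
  rw [tendsto_nhdsWithin_iff, eventually_atTop] at hu
  obtain ⟨hu1, N, hN⟩ := hu
  -- The sequence is in the support only eventually, whereas the hypothesis wants every term there;
  -- shifting by `N` repairs this.
  rw [← tendsto_add_atTop_iff_nat N]
  have h := hF z0 hz0 (fun k => u (k + N)) (fun k => hN _ (by omega))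
    ((tendsto_add_atTop_iff_nat N).2 hu1)
  rw [tendsto_iff_dist_tendsto_zero]
  refine squeeze_zero (fun _ => dist_nonneg) (fun k => ?_) h
  refine le_ciSup (f := fun t => |condF κ t (u (k + N)) - condF κ t z0|) ⟨1, ?_⟩ t
  rintro _ ⟨s, rfl⟩
  have h1 := cdf_nonneg (κ (u (k + N))) s
  have h2 := cdf_le_one (κ (u (k + N))) s
  have h3 := cdf_nonneg (κ z0) s
  have h4 := cdf_le_one (κ z0) s
  exact abs_le.2 ⟨by simp only [condF]; linarith, by simp only [condF]; linarith⟩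

lemma measureReal_Ioc_eq_cdf_sub (μ : Measure ℝ) [IsProbabilityMeasure μ] {a b : ℝ} (h : a ≤ b) :
    μ.real (Set.Ioc a b) = cdf μ b - cdf μ a := by
  rw [cdf_eq_real, cdf_eq_real, ← Set.Iic_sdiff_Iic,
    measureReal_sdiff (Set.Iic_subset_Iic.2 h) measurableSet_Iic]

lemma tendsto_kernel_Ioc {μ : Measure (ℝ × ℝ)} {κ : Kernel ℝ ℝ} [IsMarkovKernel κ]
    {Zset : Finset ℝ} (hF : CondFContinuousAtTargets μ κ Zset) {z0 : ℝ} (hz0 : z0 ∈ Zset)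
    (a b : ℝ) :
    Tendsto (fun z => (κ z).real (Set.Ioc a b)) (𝓝[(μ.map Prod.snd).support] z0)
      (𝓝 ((κ z0).real (Set.Ioc a b))) := by
  rcases le_total a b with h | h
  · simp only [measureReal_Ioc_eq_cdf_sub _ h]
    exact (tendsto_condF hF hz0 b).sub (tendsto_condF hF hz0 a)
  · simp only [Set.Ioc_eq_empty_of_le h, measureReal_empty]
    exact tendsto_const_nhds

lemma exists_forall_abs_prod_kernel_Ioc_sub_le {μ : Measure (ℝ × ℝ)} {κ : Kernel ℝ ℝ}
    [IsMarkovKernel κ] {Zset : Finset ℝ} (hF : CondFContinuousAtTargets μ κ Zset) {z0 : ℝ}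
    (hz0 : z0 ∈ Zset) {q : ℕ} (a b : Fin q → ℝ) {η : ℝ} (hη : 0 < η) :
    ∃ ε > 0, ∀ z : Fin q → ℝ, (∀ j, z j ∈ (μ.map Prod.snd).support) → (∀ j, |z j - z0| < ε) →
      |∏ j, (κ (z j)).real (Set.Ioc (a j) (b j)) -
        ∏ j, (κ z0).real (Set.Ioc (a j) (b j))| < η := by
  have hT : Tendsto (fun z : Fin q → ℝ => ∏ j, (κ (z j)).real (Set.Ioc (a j) (b j)))
      (𝓝[Set.univ.pi fun _ => (μ.map Prod.snd).support] fun _ => z0)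
      (𝓝 (∏ j, (κ z0).real (Set.Ioc (a j) (b j)))) := by
    refine tendsto_finsetProd _ fun j _ => (tendsto_kernel_Ioc hF hz0 (a j) (b j)).comp ?_
    refine tendsto_nhdsWithin_iff.2 ⟨?_, ?_⟩
    · exact (((continuous_apply j).tendsto fun _ => z0)).mono_left nhdsWithin_le_nhds
    · exact eventually_nhdsWithin_of_forall fun z hz => hz j (Set.mem_univ j)
  rw [Metric.tendsto_nhdsWithin_nhds] at hT
  obtain ⟨ε, hε, h⟩ := hT η hη
  refine ⟨ε, hε, fun z hz hd => ?_⟩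
  have := h (x := z) (fun j _ => hz j) ((dist_pi_lt_iff hε).2 hd)
  rwa [Real.dist_eq] at this

/-- Half-open boxes suit the π-system criterion for weak convergence: their probabilities are
products of cdf differences, and each point of an open set has such a box as a neighbourhood inside
that set. -/
lemma isPiSystem_pi_Ioc (q : ℕ) :
    IsPiSystem {s : Set (Fin q → ℝ) | ∃ a b : Fin q → ℝ,
      s = Set.univ.pi fun j => Set.Ioc (a j) (b j)} := by
  rintro _ ⟨a, b, rfl⟩ _ ⟨c, d, rfl⟩ -
  refine ⟨fun j => max (a j) (c j), fun j => min (b j) (d j), ?_⟩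
  rw [← Set.pi_inter_distrib]
  simp [Set.Ioc_inter_Ioc]

lemma exists_pi_Ioc_mem_nhds_subset {q : ℕ} {u : Set (Fin q → ℝ)} (hu : IsOpen u)
    {x : Fin q → ℝ} (hx : x ∈ u) :
    ∃ a b : Fin q → ℝ, Set.univ.pi (fun j => Set.Ioc (a j) (b j)) ∈ 𝓝 x ∧
      Set.univ.pi (fun j => Set.Ioc (a j) (b j)) ⊆ u := by
  obtain ⟨ε, hε, h⟩ := Metric.isOpen_iff.1 hu x hx
  refine ⟨fun j => x j - ε / 2, fun j => x j + ε / 2, ?_, fun y hy => h ?_⟩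
  · exact set_pi_mem_nhds Set.finite_univ fun j _ => Ioc_mem_nhds (by linarith) (by linarith)
  · refine (dist_pi_lt_iff hε).2 fun j => ?_
    have := hy j (Set.mem_univ j)
    rw [Real.dist_eq, abs_lt]
    constructor <;> linarith [this.1, this.2]

variable {z0 : ℝ} (r : GOrderRule z0)

/-- The law of the first `q` induced order statistics in an i.i.d. sample of size `n`. -/
noncomputable def inducedLaw (μ : Measure (ℝ × ℝ)) [IsProbabilityMeasure μ] (q n : ℕ) :
    ProbabilityMeasure (Fin q → ℝ) :=
  ⟨(Measure.pi fun _ : Fin n => μ).map fun w => inducedOrderStat r q w,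
    Measure.isProbabilityMeasure_map (measurable_inducedOrderStat r q n).aemeasurable⟩

/-- The conditional law at the target, as a probability measure. -/
noncomputable def targetLaw (κ : Kernel ℝ ℝ) [IsMarkovKernel κ] (z0 : ℝ) :
    ProbabilityMeasure ℝ := ⟨κ z0, inferInstance⟩

lemma inducedLaw_real_rect {μ : Measure (ℝ × ℝ)} [IsProbabilityMeasure μ] {κ : Kernel ℝ ℝ}
    [IsMarkovKernel κ] (hκ : IsCondLaw μ κ) {q n : ℕ} (h : q ≤ n) {B : Fin q → Set ℝ}
    (hB : ∀ j, MeasurableSet (B j)) :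
    (inducedLaw r μ q n : Measure (Fin q → ℝ)).real (Set.univ.pi B) =
      ∫ z, ∏ j, (κ (closestZ r q h z j)).real (B j)
        ∂(Measure.pi fun _ : Fin n => μ.map Prod.snd) := by
  have h1 : (inducedLaw r μ q n : Measure (Fin q → ℝ)) (Set.univ.pi B) =
      (Measure.pi fun _ : Fin n => μ) {w | ∀ j, inducedOrderStat r q w j ∈ B j} := by
    change ((Measure.pi fun _ : Fin n => μ).map _) _ = _
    rw [Measure.map_apply (measurable_inducedOrderStat r q n) (MeasurableSet.univ_pi hB)]
    congr 1
    ext w; simp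
  rw [measureReal_def, h1, pi_inducedOrderStat_rect r hκ h hB, ← integral_toReal]
  · simp [ENNReal.toReal_prod, measureReal_def]
  · refine (Finset.measurable_prod _ fun j _ => ?_).aemeasurable
    exact (κ.measurable_coe (hB j)).comp
      ((measurable_pi_apply j).comp (measurable_closestZ r h))
  · exact ae_of_all _ fun z =>
      ENNReal.prod_lt_top fun j _ => measure_lt_top _ _

lemma prod_measureReal_mem_Icc {ι α : Type*} [Fintype ι] [MeasurableSpace α] (μ : ι → Measure α)
    [∀ i, IsProbabilityMeasure (μ i)] (B : ι → Set α) :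
    ∏ i, (μ i).real (B i) ∈ Set.Icc (0 : ℝ) 1 :=
  ⟨Finset.prod_nonneg fun _ _ => measureReal_nonneg,
    Finset.prod_le_one (fun _ _ => measureReal_nonneg) fun _ _ => measureReal_le_one⟩

lemma tendsto_inducedLaw_rect {μ : Measure (ℝ × ℝ)} [IsProbabilityMeasure μ] {κ : Kernel ℝ ℝ}
    [IsMarkovKernel κ] (hκ : IsCondLaw μ κ) {Zset : Finset ℝ} (hz0 : z0 ∈ Zset)
    (hZ : ChargesTargets μ Zset) (hF : CondFContinuousAtTargets μ κ Zset) (q : ℕ)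
    (a b : Fin q → ℝ) :
    Tendsto (fun n => (inducedLaw r μ q n : Measure (Fin q → ℝ)).real
        (Set.univ.pi fun j => Set.Ioc (a j) (b j))) atTop
      (𝓝 (∏ j, (κ z0).real (Set.Ioc (a j) (b j)))) := by
  set ν := μ.map Prod.snd with hν
  have : IsProbabilityMeasure ν :=
    Measure.isProbabilityMeasure_map measurable_snd.aemeasurable
  rw [Metric.tendsto_atTop]
  intro η hη
  obtain ⟨ε, hε, hcont⟩ :=
    exists_forall_abs_prod_kernel_Ioc_sub_le hF hz0 a b (half_pos hη)
  classical
  set B : Set ℝ := {x | |x - z0| < ε} with hBdef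
  have hBm : MeasurableSet B := measurableSet_lt (by fun_prop) measurable_const
  have hBpos : 0 < ν B := by
    rw [hν, Measure.map_apply measurable_snd hBm]
    convert hZ ε hε z0 hz0 using 2
    ext p
    simp only [hBdef, Set.mem_preimage, Set.mem_ofPred_eq, Set.mem_Ioo, abs_lt]
    constructor <;> rintro ⟨h1, h2⟩ <;> constructor <;> linarith
  have hfar := (ENNReal.tendsto_toReal ENNReal.zero_ne_top).comp
    (tendsto_pi_card_lt ν hBm hBpos q)
  rw [ENNReal.toReal_zero, Metric.tendsto_atTop] at hfar
  obtain ⟨N, hN⟩ := hfar (η / 2) (half_pos hη)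
  refine ⟨max N q, fun n hn => ?_⟩
  have hqn : q ≤ n := (le_max_right _ _).trans hn
  set P := Measure.pi fun _ : Fin n => ν with hP
  set far : Set (Fin n → ℝ) := {z | (Finset.univ.filter fun i => z i ∈ B).card < q} with hfardef
  have hPfar : P.real far < η / 2 := by
    have := hN n ((le_max_left _ _).trans hn)
    rw [Real.dist_eq, sub_zero] at this
    exact (le_abs_self _).trans_lt this
  have hfarm : MeasurableSet far := by
    have hc : Measurable fun z : Fin n → ℝ => (Finset.univ.filter fun i => z i ∈ B).card := by
      simp only [Finset.card_filter]
      exact Finset.measurable_sum _ fun i _ =>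
        Measurable.ite (measurable_pi_apply i hBm) measurable_const measurable_const
    exact hc (measurableSet_Iio (a := q))
  rw [inducedLaw_real_rect r hκ hqn fun j => measurableSet_Ioc]
  set L := ∏ j, (κ z0).real (Set.Ioc (a j) (b j)) with hL
  have hL01 : L ∈ Set.Icc (0 : ℝ) 1 :=
    prod_measureReal_mem_Icc (fun _ => κ z0) fun j => Set.Ioc (a j) (b j)
  set G : (Fin n → ℝ) → ℝ :=
    fun z => ∏ j, (κ (closestZ r q hqn z j)).real (Set.Ioc (a j) (b j)) with hG
  have hG01 : ∀ z, G z ∈ Set.Icc (0 : ℝ) 1 := fun z =>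
    prod_measureReal_mem_Icc (fun j => κ (closestZ r q hqn z j)) fun j => Set.Ioc (a j) (b j)
  have hGm : Measurable G := Finset.measurable_prod _ fun j _ =>
    ((κ.measurable_coe measurableSet_Ioc).ennreal_toReal).comp
      ((measurable_pi_apply j).comp (measurable_closestZ r hqn))
  have hGi : Integrable G P := Integrable.of_bound hGm.aestronglyMeasurable 1
    (ae_of_all _ fun z => by rw [Real.norm_eq_abs, abs_of_nonneg (hG01 z).1]; exact (hG01 z).2)
  have hsupp : ∀ᵐ z ∂P, ∀ i, z i ∈ ν.support := by
    refine eventually_all.2 fun i => ?_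
    exact (Measure.tendsto_eval_ae_ae (i := i)).eventually
      (p := fun x : ℝ => x ∈ ν.support) Measure.support_mem_ae
  -- Off `far` the `q` closest values are within `ε` of `z0`; on `far`, of probability below `η /
  -- 2`, the trivial bound for numbers in `[0, 1]` suffices.
  have hpt : ∀ᵐ z ∂P, ‖G z - L‖ ≤ η / 2 + far.indicator (fun _ => (1 : ℝ)) z := by
    filter_upwards [hsupp] with z hz
    rw [Real.norm_eq_abs]
    by_cases hzf : z ∈ far
    · rw [Set.indicator_of_mem hzf]
      have h1 := hG01 z
      exact abs_le.2 ⟨by linarith [h1.1, hL01.2], by linarith [h1.2, hL01.1]⟩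
    · rw [Set.indicator_of_notMem hzf, add_zero]
      refine (hcont _ (fun j => hz _) fun j => ?_).le
      exact abs_closestZ_sub_lt r hqn z (not_lt.1 hzf) j
  have hint : Integrable (fun z => η / 2 + far.indicator (fun _ => (1 : ℝ)) z) P :=
    (integrable_const _).add ((integrable_const _).indicator hfarm)
  have hsub : ∫ z, G z ∂P - L = ∫ z, (G z - L) ∂P := by
    rw [integral_sub hGi (integrable_const _)]; simp
  rw [Real.dist_eq, hsub, ← Real.norm_eq_abs]
  calc ‖∫ z, (G z - L) ∂P‖ ≤ ∫ z, (η / 2 + far.indicator (fun _ => (1 : ℝ)) z) ∂P :=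
        norm_integral_le_of_norm_le hint hpt
    _ = η / 2 + P.real far := by
        rw [integral_add (integrable_const _) ((integrable_const _).indicator hfarm),
          integral_indicator_const _ hfarm]
        simp
    _ < η := by linarith

theorem tendsto_inducedLaw {μ : Measure (ℝ × ℝ)} [IsProbabilityMeasure μ] {κ : Kernel ℝ ℝ}
    [IsMarkovKernel κ] (hκ : IsCondLaw μ κ) {Zset : Finset ℝ} (hz0 : z0 ∈ Zset)
    (hZ : ChargesTargets μ Zset) (hF : CondFContinuousAtTargets μ κ Zset) (q : ℕ) :
    Tendsto (inducedLaw r μ q) atTop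
      (𝓝 (ProbabilityMeasure.pi fun _ : Fin q => targetLaw κ z0)) := by
  refine (isPiSystem_pi_Ioc q).tendsto_probabilityMeasure_of_tendsto_of_mem ?_ ?_ ?_
  · rintro _ ⟨a, b, rfl⟩
    exact MeasurableSet.univ_pi fun _ => measurableSet_Ioc
  · intro u hu x hx
    obtain ⟨a, b, h1, h2⟩ := exists_pi_Ioc_mem_nhds_subset hu hx
    exact ⟨_, ⟨a, b, rfl⟩, h1, h2⟩
  · rintro _ ⟨a, b, rfl⟩
    rw [← NNReal.tendsto_coe]
    rw [ProbabilityMeasure.pi_pi, NNReal.coe_prod]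
    exact tendsto_inducedLaw_rect r hκ hz0 hZ hF q a b

end WeakLimit

/-! ### The pooled sample -/

section Pooled

lemma continuous_finAppend (m n : ℕ) :
    Continuous fun p : (Fin m → ℝ) × (Fin n → ℝ) => (Fin.append p.1 p.2 : Fin (m + n) → ℝ) := by
  refine continuous_pi fun i => ?_
  refine Fin.addCases (fun j => ?_) (fun j => ?_) i
  · simp only [Fin.append_left]; fun_prop
  · simp only [Fin.append_right]; fun_prop

lemma map_append_prod_pi {m n : ℕ} (μ : Fin m → Measure ℝ) (ν : Fin n → Measure ℝ)
    (ρ : Fin (m + n) → Measure ℝ) [∀ i, IsProbabilityMeasure (μ i)]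
    [∀ i, IsProbabilityMeasure (ν i)] [∀ i, IsProbabilityMeasure (ρ i)]
    (hμ : ∀ j, ρ (Fin.castAdd n j) = μ j) (hν : ∀ j, ρ (Fin.natAdd m j) = ν j) :
    ((Measure.pi μ).prod (Measure.pi ν)).map (fun p => (Fin.append p.1 p.2 : Fin (m + n) → ℝ)) =
      Measure.pi ρ := by
  refine (Measure.pi_eq fun s hs => ?_).symm
  rw [Measure.map_apply (continuous_finAppend m n).measurable (MeasurableSet.univ_pi hs)]
  have : (fun p : (Fin m → ℝ) × (Fin n → ℝ) => (Fin.append p.1 p.2 : Fin (m + n) → ℝ)) ⁻¹'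
      (Set.univ.pi s) = (Set.univ.pi fun j => s (Fin.castAdd n j)) ×ˢ
        (Set.univ.pi fun j => s (Fin.natAdd m j)) := by
    ext p
    simp only [Set.mem_preimage, Set.mem_pi, Set.mem_univ, true_implies, Set.mem_prod]
    constructor
    · intro h
      exact ⟨fun j => by simpa using h (Fin.castAdd n j), fun j => by simpa using h (Fin.natAdd m j)⟩
    · rintro ⟨h1, h2⟩ i
      refine Fin.addCases (fun j => ?_) (fun j => ?_) i
      · simpa using h1 j
      · simpa using h2 j
  rw [this, Measure.prod_prod, Measure.pi_pi, Measure.pi_pi, Fin.prod_univ_add]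
  simp [hμ, hν]

/-- The family of marginal laws of the limit of the pooled sample. -/
noncomputable def limitMarginal (κY κX : Kernel ℝ ℝ) (z0 : ℝ) (qy qx : ℕ) :
    Fin (qy + qx) → Measure ℝ :=
  Fin.addCases (motive := fun _ => Measure ℝ) (fun _ => κY z0) (fun _ => κX z0)

instance (κY κX : Kernel ℝ ℝ) [IsMarkovKernel κY] [IsMarkovKernel κX] (z0 : ℝ) (qy qx : ℕ)
    (i : Fin (qy + qx)) : IsProbabilityMeasure (limitMarginal κY κX z0 qy qx i) := by
  refine Fin.addCases (fun j => ?_) (fun j => ?_) i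
  · simp only [limitMarginal, Fin.addCases_left]; infer_instance
  · simp only [limitMarginal, Fin.addCases_right]; infer_instance

lemma measurable_pooled {z0 : ℝ} (rY rX : GOrderRule z0) (qy qx ny nx : ℕ) :
    Measurable fun w : (Fin ny → ℝ × ℝ) × (Fin nx → ℝ × ℝ) => pooled rY rX qy qx w :=
  (continuous_finAppend qy qx).measurable.comp
    (((measurable_inducedOrderStat rY qy ny).comp measurable_fst).prodMk
      ((measurable_inducedOrderStat rX qx nx).comp measurable_snd))

/-- If the limit law does not charge the boundary of `E`, the pooled induced order statistics fall
into `E` with asymptotically the probability under the limit law. -/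
theorem tendsto_samplingLaw_pooled {PY PX : Measure (ℝ × ℝ)} [IsProbabilityMeasure PY]
    [IsProbabilityMeasure PX] {κY κX : Kernel ℝ ℝ} [IsMarkovKernel κY] [IsMarkovKernel κX]
    (hκY : IsCondLaw PY κY) (hκX : IsCondLaw PX κX) {Zset : Finset ℝ} {z0 : ℝ}
    (hz0 : z0 ∈ Zset) (hZY : ChargesTargets PY Zset) (hZX : ChargesTargets PX Zset)
    (hFY : CondFContinuousAtTargets PY κY Zset) (hFX : CondFContinuousAtTargets PX κX Zset)
    (rY rX : GOrderRule z0) (qy qx : ℕ) {E : Set (Fin (qy + qx) → ℝ)} (hE : MeasurableSet E)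
    (hfr : Measure.pi (limitMarginal κY κX z0 qy qx) (frontier E) = 0) :
    Tendsto (fun n : ℕ × ℕ => samplingLaw PY PX n.1 n.2 {w | pooled rY rX qy qx w ∈ E})
      (comap (fun n : ℕ × ℕ => min n.1 n.2) atTop)
      (𝓝 (Measure.pi (limitMarginal κY κX z0 qy qx) E)) := by
  have hmin : Tendsto (fun n : ℕ × ℕ => min n.1 n.2)
      (comap (fun n : ℕ × ℕ => min n.1 n.2) atTop) atTop := tendsto_comap
  have h1 := (tendsto_inducedLaw rY hκY hz0 hZY hFY qy).comp
    (tendsto_atTop_mono (fun n : ℕ × ℕ => min_le_left n.1 n.2) hmin)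
  have h2 := (tendsto_inducedLaw rX hκX hz0 hZX hFX qx).comp
    (tendsto_atTop_mono (fun n : ℕ × ℕ => min_le_right n.1 n.2) hmin)
  have h3 := (ProbabilityMeasure.continuous_prod.tendsto _).comp (h1.prodMk_nhds h2)
  have h4 := ((ProbabilityMeasure.continuous_map (continuous_finAppend qy qx)).tendsto _).comp h3
  set lim : ProbabilityMeasure (Fin (qy + qx) → ℝ) :=
    ⟨Measure.pi (limitMarginal κY κX z0 qy qx), inferInstance⟩
  have h5 : ((ProbabilityMeasure.pi fun _ : Fin qy => targetLaw κY z0).prod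
      (ProbabilityMeasure.pi fun _ : Fin qx => targetLaw κX z0)).map
      (continuous_finAppend qy qx).measurable.aemeasurable = lim := by
    apply Subtype.ext
    exact map_append_prod_pi (fun _ => κY z0) (fun _ => κX z0) (limitMarginal κY κX z0 qy qx)
      (fun j => by simp [limitMarginal]) (fun j => by simp [limitMarginal])
  have h6 := ProbabilityMeasure.tendsto_measure_of_null_frontier_of_tendsto' (μ := lim)
    (by rw [← h5]; exact h4) (E := E) hfr
  refine h6.congr fun n => ?_
  change (((Measure.pi fun _ : Fin n.1 => PY).map _).prod
    ((Measure.pi fun _ : Fin n.2 => PX).map _)).map _ E = _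
  rw [Measure.map_prod_map _ _ (measurable_inducedOrderStat rY qy n.1)
    (measurable_inducedOrderStat rX qx n.2),
    Measure.map_map (continuous_finAppend qy qx).measurable
      ((measurable_inducedOrderStat rY qy n.1).prodMap (measurable_inducedOrderStat rX qx n.2)),
    Measure.map_apply ((continuous_finAppend qy qx).measurable.comp
      ((measurable_inducedOrderStat rY qy n.1).prodMap (measurable_inducedOrderStat rX qx n.2))) hE]
  rfl

end Pooled

end CSD

namespace CSD

/-! ### The Cramér–von Mises statistic as a function of the ranks -/

section Statistic

variable {qy qx : ℕ}

lemma empY_eq_card (s : Fin (qy + qx) → ℝ) (t : ℝ) :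
    empY s t = (1 / (qy : ℝ)) *
      ((Finset.univ.filter fun j : Fin qy => s (Fin.castAdd qx j) ≤ t).card : ℝ) := by
  simp [empY]

lemma empX_eq_card (s : Fin (qy + qx) → ℝ) (t : ℝ) :
    empX s t = (1 / (qx : ℝ)) *
      ((Finset.univ.filter fun j : Fin qx => s (Fin.natAdd qy j) ≤ t).card : ℝ) := by
  simp [empX]

lemma cvmStat_congr {s v : Fin (qy + qx) → ℝ} (h : ∀ i j, s i ≤ s j ↔ v i ≤ v j) :
    cvmStat s = cvmStat v := by
  simp only [cvmStat, empY, empX, h]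

lemma measurable_cvmStat : Measurable fun s : Fin (qy + qx) → ℝ => cvmStat s := by
  have h : ∀ i j : Fin (qy + qx),
      Measurable fun s : Fin (qy + qx) → ℝ => if s i ≤ s j then (1 : ℝ) else 0 := fun i j =>
    Measurable.ite (measurableSet_le (measurable_pi_apply i) (measurable_pi_apply j))
      measurable_const measurable_const
  unfold cvmStat empY empX
  refine (Finset.measurable_sum _ fun j _ => ?_).const_mul _
  refine Measurable.pow_const (Measurable.max (Measurable.sub ?_ ?_) measurable_const) _
  · exact (Finset.measurable_sum _ fun i _ => h _ j).const_mul _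
  · exact (Finset.measurable_sum _ fun i _ => h _ j).const_mul _

/-- Without ties all comparisons are strict, hence stable under small perturbations. -/
lemma eventually_cvmStat_eq {s : Fin (qy + qx) → ℝ} (hs : Function.Injective s) :
    ∀ᶠ v in 𝓝 s, cvmStat v = cvmStat s := by
  have h : ∀ i j, ∀ᶠ v in 𝓝 s, (v i ≤ v j ↔ s i ≤ s j) := by
    intro i j
    rcases lt_trichotomy (s i) (s j) with hij | hij | hij
    · filter_upwards [(continuous_apply i).continuousAt.eventually_lt
        (continuous_apply j).continuousAt hij] with v hv
      exact ⟨fun _ => hij.le, fun _ => le_of_lt hv⟩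
    · rw [hs hij]; simp
    · filter_upwards [(continuous_apply j).continuousAt.eventually_lt
        (continuous_apply i).continuousAt hij] with v hv
      exact ⟨fun h => absurd h (not_le.2 hv), fun h => absurd h (not_le.2 hij)⟩
  filter_upwards [eventually_all.2 fun i => eventually_all.2 (h i)] with v hv
  exact cvmStat_congr hv

lemma frontier_lt_cvmStat_subset (c : ℝ) :
    frontier {s : Fin (qy + qx) → ℝ | c < cvmStat s} ⊆ {s | ¬ Function.Injective s} := by
  intro s hs hinj
  have h := eventually_cvmStat_eq hinj
  by_cases hc : c < cvmStat s
  · exact hs.2 (mem_interior_iff_mem_nhds.2 (h.mono fun v hv => by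
      simp only [hv, hc]))
  · obtain ⟨v, hv, hv2⟩ := ((mem_closure_iff_frequently.1 hs.1).and_eventually h).exists
    exact hc (hv2 ▸ hv)

lemma card_filter_le_sort {n : ℕ} {s : Fin n → ℝ} (hs : Function.Injective s) (k : Fin n) :
    (Finset.univ.filter fun i => s i ≤ s (Tuple.sort s k)).card = k + 1 := by
  have hm : StrictMono (s ∘ Tuple.sort s) :=
    (Tuple.monotone_sort s).strictMono_of_injective (hs.comp (Tuple.sort s).injective)
  have : (Finset.univ.filter fun i => s i ≤ s (Tuple.sort s k)) =
      (Finset.Iic k).map (Tuple.sort s).toEmbedding := by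
    ext i
    obtain ⟨l, rfl⟩ := (Tuple.sort s).surjective i
    have := hm.le_iff_le (a := l) (b := k)
    simpa using this
  rw [this, Finset.card_map, Fin.card_Iic]

lemma card_filter_append (s : Fin (qy + qx) → ℝ) (a : ℝ) :
    (Finset.univ.filter fun i => s i ≤ a).card =
      (Finset.univ.filter fun j : Fin qy => s (Fin.castAdd qx j) ≤ a).card +
      (Finset.univ.filter fun j : Fin qx => s (Fin.natAdd qy j) ≤ a).card := by
  simp only [Finset.card_filter, Fin.sum_univ_add]

/-- If `s` had more `Y`-values below its level than `v`, equal totals would force fewer `X`-values.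
Some `Y_i` would then be counted only in `s` and some `X_j` only in `v`. But `s_i ≤ a < s_j` gives
`v_i ≤ v_j ≤ b`, a contradiction. -/
lemma empY_le_and_empX_le {s v : Fin (qy + qx) → ℝ} {a b : ℝ}
    (hcard : (Finset.univ.filter fun i => s i ≤ a).card =
      (Finset.univ.filter fun i => v i ≤ b).card)
    (h : ∀ (i : Fin qy) (j : Fin qx), s (Fin.castAdd qx i) ≤ s (Fin.natAdd qy j) →
      v (Fin.castAdd qx i) ≤ v (Fin.natAdd qy j)) :
    empY s a ≤ empY v b ∧ empX v b ≤ empX s a := by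
  rw [card_filter_append, card_filter_append] at hcard
  have hY : (Finset.univ.filter fun j : Fin qy => s (Fin.castAdd qx j) ≤ a).card ≤
      (Finset.univ.filter fun j : Fin qy => v (Fin.castAdd qx j) ≤ b).card := by
    by_contra hlt
    rw [not_le] at hlt
    have hlt' : (Finset.univ.filter fun j : Fin qx => s (Fin.natAdd qy j) ≤ a).card <
      (Finset.univ.filter fun j : Fin qx => v (Fin.natAdd qy j) ≤ b).card := by omega
    obtain ⟨i, hi, hi'⟩ := Finset.exists_mem_notMem_of_card_lt_card hlt
    obtain ⟨j, hj, hj'⟩ := Finset.exists_mem_notMem_of_card_lt_card hlt'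
    simp only [Finset.mem_filter, Finset.mem_univ, true_and, not_le] at hi hi' hj hj'
    exact absurd ((h i j (hi.trans hj'.le)).trans hj) (not_le.2 hi')
  rw [empY_eq_card, empY_eq_card, empX_eq_card, empX_eq_card]
  constructor
  · gcongr
  · have hX : (Finset.univ.filter fun j : Fin qx => v (Fin.natAdd qy j) ≤ b).card ≤
      (Finset.univ.filter fun j : Fin qx => s (Fin.natAdd qy j) ≤ a).card := by omega
    gcongr

/-- In the absence of ties, the statistic increases when `Y`-values move down past `X`-values. -/
theorem cvmStat_le_of_forall {s v : Fin (qy + qx) → ℝ} (hs : Function.Injective s)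
    (hv : Function.Injective v)
    (h : ∀ (i : Fin qy) (j : Fin qx), s (Fin.castAdd qx i) ≤ s (Fin.natAdd qy j) →
      v (Fin.castAdd qx i) ≤ v (Fin.natAdd qy j)) :
    cvmStat s ≤ cvmStat v := by
  unfold cvmStat
  -- Summing by rank pairs the `k`-th smallest entry of `s` with that of `v`; both levels have
  -- exactly `k + 1` entries at or below them.
  rw [← Equiv.sum_comp (Tuple.sort s) fun j => (max (empY s (s j) - empX s (s j)) 0) ^ 2,
    ← Equiv.sum_comp (Tuple.sort v) fun j => (max (empY v (v j) - empX v (v j)) 0) ^ 2]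
  refine mul_le_mul_of_nonneg_left (Finset.sum_le_sum fun k _ => ?_) (by positivity)
  obtain ⟨h1, h2⟩ := empY_le_and_empX_le
    ((card_filter_le_sort hs k).trans (card_filter_le_sort hv k).symm) h
  gcongr

end Statistic

/-! ### Continuous distribution functions and uniform variables -/

section Uniform

lemma nullSingletonClass_of_continuous_cdf (μ : Measure ℝ) [IsProbabilityMeasure μ]
    (h : Continuous (cdf μ)) : NullSingletonClass μ := by
  refine ⟨fun x => ?_⟩
  rw [← measure_cdf μ, StieltjesFunction.measure_singleton,
    h.continuousAt.continuousWithinAt.leftLim_eq]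
  simp

/-- Two distinct coordinates have a product law, and the slices of the diagonal are singletons,
which are null. -/
lemma pi_ae_injective {n : ℕ} (μ : Fin n → Measure ℝ) [∀ i, IsProbabilityMeasure (μ i)]
    [∀ i, NullSingletonClass (μ i)] : ∀ᵐ s ∂(Measure.pi μ), Function.Injective s := by
  have h : ∀ i j, i ≠ j → ∀ᵐ s ∂(Measure.pi μ), s i ≠ s j := by
    intro i j hij
    have hind := (iIndepFun_pi (μ := μ) (X := fun _ => id) fun _ => aemeasurable_id).indepFun hij
    have hmap := (indepFun_iff_map_prod_eq_prod_map_map (measurable_pi_apply i).aemeasurable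
      (measurable_pi_apply j).aemeasurable).1 hind
    have hi : (Measure.pi μ).map (fun s => s i) = μ i := (measurePreserving_eval μ i).map_eq
    have hj : (Measure.pi μ).map (fun s => s j) = μ j := (measurePreserving_eval μ j).map_eq
    rw [hi, hj] at hmap
    have hd : (μ i).prod (μ j) (Set.diagonal ℝ) = 0 := by
      rw [Measure.measure_prod_null measurableSet_diagonal]
      refine ae_of_all _ fun x => ?_
      have : Prod.mk x ⁻¹' Set.diagonal ℝ = {x} := by ext y; simp [eq_comm]
      simp [this]
    rw [← hmap, Measure.map_apply (by fun_prop) measurableSet_diagonal] at hd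
    exact measure_eq_zero_iff_ae_notMem.1 hd
  have h2 : ∀ᵐ s ∂(Measure.pi μ), ∀ i j, i ≠ j → s i ≠ s j :=
    eventually_all.2 fun i => eventually_all.2 fun j => by
      by_cases hij : i = j
      · simp [hij]
      · filter_upwards [h i j hij] with s hs _ using hs
  filter_upwards [h2] with s hs i j hij
  by_contra hne
  exact hs i j hne hij

instance isProbabilityMeasure_restrict_Ioo :
    IsProbabilityMeasure (volume.restrict (Set.Ioo (0 : ℝ) 1)) := ⟨by simp⟩

instance (q : ℕ) : IsProbabilityMeasure (uniformLaw q) := by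
  unfold uniformLaw; infer_instance

/-- The probability integral transform. -/
theorem map_cdf_of_continuous (μ : Measure ℝ) [IsProbabilityMeasure μ] (h : Continuous (cdf μ)) :
    μ.map (cdf μ) = volume.restrict (Set.Ioo (0 : ℝ) 1) := by
  have : IsProbabilityMeasure (μ.map (cdf μ)) :=
    Measure.isProbabilityMeasure_map h.measurable.aemeasurable
  have hsurj : ∀ t ∈ Set.Ioo (0 : ℝ) 1, ∃ x, cdf μ x = t := fun t ht =>
    mem_range_of_exists_le_of_exists_ge h
      (((tendsto_cdf_atBot μ).eventually (gt_mem_nhds ht.1)).exists.imp fun _ hx => le_of_lt hx)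
      (((tendsto_cdf_atTop μ).eventually (lt_mem_nhds ht.2)).exists.imp fun _ hx => le_of_lt hx)
  refine Measure.eq_of_cdf _ _ (StieltjesFunction.ext fun t => ?_)
  rw [cdf_eq_real, cdf_eq_real, map_measureReal_apply h.measurable measurableSet_Iic,
    measureReal_restrict_apply measurableSet_Iic]
  rcases lt_or_ge t 0 with ht0 | ht0
  · have h1 : cdf μ ⁻¹' Set.Iic t = ∅ := by
      ext x
      simpa using ht0.trans_le (cdf_nonneg μ x)
    have h2 : Set.Iic t ∩ Set.Ioo (0 : ℝ) 1 = ∅ := by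
      ext x
      simp only [Set.mem_inter_iff, Set.mem_Iic, Set.mem_Ioo, Set.mem_empty_iff_false, iff_false]
      rintro ⟨h1, h2, -⟩
      linarith
    simp [h1, h2]
  rcases le_or_gt 1 t with ht1 | ht1
  · have h1 : cdf μ ⁻¹' Set.Iic t = Set.univ := by
      ext x
      simpa using (cdf_le_one μ x).trans ht1
    have h2 : Set.Iic t ∩ Set.Ioo (0 : ℝ) 1 = Set.Ioo 0 1 :=
      Set.inter_eq_right.2 fun x hx => hx.2.le.trans ht1
    simp [h1, h2, measureReal_def]
  · have h2 : Set.Iic t ∩ Set.Ioo (0 : ℝ) 1 = Set.Ioc 0 t := by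
      ext x
      simp only [Set.mem_inter_iff, Set.mem_Iic, Set.mem_Ioo, Set.mem_Ioc]
      exact ⟨fun h => ⟨h.2.1, h.1⟩, fun h => ⟨h.2, h.1, h.2.trans_lt ht1⟩⟩
    rw [h2, measureReal_def volume, Real.volume_Ioc, sub_zero, ENNReal.toReal_ofReal ht0]
    -- The cdf may be flat at height `t`, so a point where it equals `t` need not bound `{cdf ≤ t}`
    -- from above; a point where it equals some `t' > t` does.
    refine le_antisymm (le_of_forall_gt_imp_ge_of_dense fun t' ht' => ?_) ?_
    · rcases le_or_gt 1 t' with h1 | h1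
      · exact measureReal_le_one.trans h1
      · obtain ⟨x, hx⟩ := hsurj t' ⟨ht0.trans_lt ht', h1⟩
        rw [← hx, cdf_eq_real]
        refine measureReal_mono fun y hy => ?_
        by_contra hxy
        rw [Set.mem_Iic, not_le] at hxy
        have h3 := monotone_cdf μ hxy.le
        rw [hx] at h3
        exact absurd (h3.trans hy) (not_le.2 ht')
    -- The value `0` may not be attained by the cdf, so `t = 0` is separate.
    · rcases ht0.eq_or_lt with h0 | h0
      · rw [← h0]; exact measureReal_nonneg
      · obtain ⟨x, hx⟩ := hsurj t ⟨h0, ht1⟩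
        nth_rw 1 [← hx]
        rw [cdf_eq_real]
        exact measureReal_mono fun y hy => (monotone_cdf μ hy).trans hx.le

/-- The test has level `α` when the pooled sample is i.i.d. uniform. -/
theorem uniformLaw_cvmCritical_lt_le {α : ℝ} (hα : α ∈ Set.Ioo (0 : ℝ) 1) (qy qx : ℕ) :
    (uniformLaw (qy + qx)).real {u | cvmCritical α qy qx < cvmStat (qy := qy) (qx := qx) u} ≤
      α := by
  set P := uniformLaw (qy + qx) with hP
  set ρ := P.map fun u => cvmStat (qy := qy) (qx := qx) u with hρ
  have : IsProbabilityMeasure ρ :=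
    Measure.isProbabilityMeasure_map measurable_cvmStat.aemeasurable
  have hcdf : ∀ x, P.real {u | cvmStat (qy := qy) (qx := qx) u ≤ x} = cdf ρ x := fun x => by
    rw [cdf_eq_real, hρ, map_measureReal_apply measurable_cvmStat measurableSet_Iic]
    rfl
  have hc : cvmCritical α qy qx = sInf {x | 1 - α ≤ cdf ρ x} := by
    simp only [cvmCritical, ← hP, hcdf]
  set c := cvmCritical α qy qx
  have hne : {x | 1 - α ≤ cdf ρ x}.Nonempty :=
    ((tendsto_cdf_atTop ρ).eventually (lt_mem_nhds (by linarith [hα.1] : 1 - α < 1))).exists.imp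
      fun _ hx => le_of_lt hx
  have hgt : ∀ x, c < x → 1 - α ≤ cdf ρ x := by
    intro x hx
    rw [hc] at hx
    obtain ⟨y, hy, hyx⟩ := exists_lt_of_csInf_lt hne hx
    exact le_trans hy (monotone_cdf ρ hyx.le)
  -- Right continuity of the cdf carries the quantile inequality to the infimum itself.
  have hge : 1 - α ≤ cdf ρ c := by
    refine ge_of_tendsto (((cdf ρ).right_continuous c).mono_left
      (nhdsWithin_mono c Set.Ioi_subset_Ici_self)) ?_
    exact eventually_nhdsWithin_of_forall hgt
  have hcompl : {u | c < cvmStat (qy := qy) (qx := qx) u} =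
      {u | cvmStat (qy := qy) (qx := qx) u ≤ c}ᶜ := by ext; simp
  rw [hcompl, probReal_compl_eq_one_sub (measurableSet_le measurable_cvmStat measurable_const),
    hcdf]
  linarith

end Uniform

/-! ### Size of the test -/

section Size

/-- Under the null hypothesis, the limit experiment rejects with probability at most `α`. -/
theorem pi_limitMarginal_cvmCritical_lt_le {κY κX : Kernel ℝ ℝ} [IsMarkovKernel κY]
    [IsMarkovKernel κX] {z0 : ℝ} (hY : Continuous (cdf (κY z0))) (hX : Continuous (cdf (κX z0)))
    (hle : ∀ t, cdf (κY z0) t ≤ cdf (κX z0) t) {α : ℝ} (hα : α ∈ Set.Ioo (0 : ℝ) 1)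
    (qy qx : ℕ) [∀ i, NullSingletonClass (limitMarginal κY κX z0 qy qx i)] :
    (Measure.pi (limitMarginal κY κX z0 qy qx)).real
      {s | cvmCritical α qy qx < cvmStat (qy := qy) (qx := qx) s} ≤ α := by
  set M := limitMarginal κY κX z0 qy qx with hM
  have hMY : ∀ i, M (Fin.castAdd qx i) = κY z0 := fun i => by simp [hM, limitMarginal]
  have hMX : ∀ j, M (Fin.natAdd qy j) = κX z0 := fun j => by simp [hM, limitMarginal]
  have hcont : ∀ i, Continuous (cdf (M i)) := fun i => by
    refine Fin.addCases (fun j => ?_) (fun j => ?_) i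
    · rwa [hMY]
    · rwa [hMX]
  set V : (Fin (qy + qx) → ℝ) → Fin (qy + qx) → ℝ := fun s i => cdf (M i) (s i) with hV
  have hVm : Measurable V := measurable_pi_lambda _ fun i =>
    (hcont i).measurable.comp (measurable_pi_apply i)
  have hmap : (Measure.pi M).map V = uniformLaw (qy + qx) := by
    have : ∀ i, SigmaFinite ((M i).map (cdf (M i))) := fun i => by
      rw [map_cdf_of_continuous _ (hcont i)]; infer_instance
    rw [hV, Measure.pi_map_pi fun i => (hcont i).measurable.aemeasurable]
    simp only [map_cdf_of_continuous _ (hcont _)]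
    rfl
  -- The cdfs need not be injective and differ between the samples, so absence of ties in `V s` is
  -- read off from its uniform law.
  have hVinj : ∀ᵐ s ∂(Measure.pi M), Function.Injective (V s) := by
    refine ae_of_ae_map (f := V) hVm.aemeasurable ?_
    rw [hmap]
    exact pi_ae_injective fun _ : Fin (qy + qx) => volume.restrict (Set.Ioo (0 : ℝ) 1)
  have hmono : ∀ᵐ s ∂(Measure.pi M), cvmStat s ≤ cvmStat (V s) := by
    filter_upwards [pi_ae_injective M, hVinj] with s hs hVs
    refine cvmStat_le_of_forall hs hVs fun i j hij => ?_
    simp only [hV, hMY, hMX]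
    exact (monotone_cdf _ hij).trans (hle _)
  calc (Measure.pi M).real {s | cvmCritical α qy qx < cvmStat s}
      ≤ (Measure.pi M).real (V ⁻¹' {u | cvmCritical α qy qx < cvmStat u}) := by
        refine ENNReal.toReal_mono (measure_ne_top _ _) (measure_mono_ae ?_)
        filter_upwards [hmono] with s hs h using lt_of_lt_of_le h hs
    _ = (uniformLaw (qy + qx)).real {u | cvmCritical α qy qx < cvmStat u} := by
        rw [← hmap, map_measureReal_apply hVm
          (measurableSet_lt measurable_const measurable_cvmStat)]
    _ ≤ α := uniformLaw_cvmCritical_lt_le hα qy qx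

lemma cvmRejection_eq_measureReal {PY PX : Measure (ℝ × ℝ)} {z0 : ℝ} (rY rX : GOrderRule z0)
    (α : ℝ) (qy qx ny nx : ℕ) :
    cvmRejection PY PX rY rX α qy qx ny nx = (samplingLaw PY PX ny nx).real
      {w | pooled rY rX qy qx w ∈ {s | cvmCritical α qy qx < cvmStat s}} := by
  have hm : MeasurableSet {w : (Fin ny → ℝ × ℝ) × (Fin nx → ℝ × ℝ) |
      pooled rY rX qy qx w ∈ {s | cvmCritical α qy qx < cvmStat s}} :=
    measurable_pooled rY rX qy qx ny nx (measurableSet_lt measurable_const measurable_cvmStat)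
  rw [← integral_indicator_one hm, cvmRejection]
  refine integral_congr_ae (ae_of_all _ fun w => ?_)
  simp [cvmTest, Set.indicator_apply]

end Size

end CSD

theorem mainTheorem7
    (PY PX : Measure (ℝ × ℝ)) [IsProbabilityMeasure PY] [IsProbabilityMeasure PX]
    (κY κX : Kernel ℝ ℝ) [IsMarkovKernel κY] [IsMarkovKernel κX]
    (hκY : CSD.IsCondLaw PY κY) (hκX : CSD.IsCondLaw PX κX)
    (Zset : Finset ℝ) (z0 : ℝ) (hz0 : z0 ∈ Zset)
    (hZY : CSD.ChargesTargets PY Zset) (hZX : CSD.ChargesTargets PX Zset)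
    (hFY : CSD.CondFContinuousAtTargets PY κY Zset)
    (hFX : CSD.CondFContinuousAtTargets PX κX Zset)
    (hYcont : Continuous fun t : ℝ => CSD.condF κY t z0)
    (hXcont : Continuous fun t : ℝ => CSD.condF κX t z0)
    (hnull : CSD.NullHypothesis κY κX Zset)
    (rY rX : CSD.GOrderRule z0)
    (qy qx : ℕ) (hqy : 0 < qy) (hqx : 0 < qx)
    (α : ℝ) (hα : α ∈ Set.Ioo (0 : ℝ) 1) :
    limsup (fun n : ℕ × ℕ => CSD.cvmRejection PY PX rY rX α qy qx n.1 n.2)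
      (comap (fun n : ℕ × ℕ => min n.1 n.2) atTop) ≤ α := by
  have : ∀ i, NullSingletonClass (CSD.limitMarginal κY κX z0 qy qx i) := fun i => by
    refine Fin.addCases (fun j => ?_) (fun j => ?_) i
    · rw [CSD.limitMarginal, Fin.addCases_left]
      exact CSD.nullSingletonClass_of_continuous_cdf _ hYcont
    · rw [CSD.limitMarginal, Fin.addCases_right]
      exact CSD.nullSingletonClass_of_continuous_cdf _ hXcont
  have hlim := CSD.tendsto_samplingLaw_pooled hκY hκX hz0 hZY hZX hFY hFX rY rX qy qx
    (E := {s | CSD.cvmCritical α qy qx < CSD.cvmStat s})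
    (measurableSet_lt measurable_const CSD.measurable_cvmStat)
    (measure_mono_null (CSD.frontier_lt_cvmStat_subset _) (CSD.pi_ae_injective _))
  have hlim' := (ENNReal.tendsto_toReal (measure_ne_top _ _)).comp hlim
  -- Nontriviality of the filter is what identifies the limsup with the limit.
  have hne : (comap (fun n : ℕ × ℕ => min n.1 n.2) (atTop : Filter ℕ)).NeBot :=
    NeBot.comap_of_surj inferInstance fun m => ⟨(m, m), min_self m⟩
  simp only [CSD.cvmRejection_eq_measureReal]
  exact hlim'.limsup_eq.trans_le
    (CSD.pi_limitMarginal_cvmCritical_lt_le hYcont hXcont (fun t => hnull t z0 hz0) hα qy qx)
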